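/- Let $n\in\mathbb{N}$, let $V,W$ be finite-dimensional real vector spaces, let $\Omega\subset\mathbb{R}^n$ be open, and let $\mathbb{A}u=\sum_{j=1}^{n}\mathbb{A}_j\partial_j u$ with linear maps $\mathbb{A}_j\colon V\to W$. For $\xi\in\mathbb{R}^n$ put $\mathbb{A}[\xi]:=\sum_{j=1}^{n}\xi_j\mathbb{A}_j\colon V\to W$. Suppose that $\mathbb{A}$ has constant rank, i.e. $\dim(\operatorname{im}\mathbb{A}[\xi])$ is the same for all $\xi\in\mathbb{R}^n\setminus\{0\}$, and call $\mathbb{A}$ elliptic if $\mathbb{A}[\xi]$ is injective for every $\xi\in\mathbb{R}^n\setminus\{0\}$. Elements of $L^1_{\mathrm{loc}}(\Omega;V)$ are identified if they agree almost everywhere. (a) If $\mathbb{A}$ is elliptic, then every $u\in L^1_{\mathrm{loc}}(\Omega;V)$ with $\mathbb{A}u=0$ in the sense of distributions on $\Omega$ agrees almost everywhere in $\Omega$ with a function in $C^\infty(\Omega;V)$. (b) If $\mathbb{A}$ is not elliptic, then there exists $v\in L^1_{\mathrm{loc}}(\Omega;V)$ with $\mathbb{A}v=0$ in the sense of distributions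 on $\Omega$ such that for no non-empty open subset $\omega\subset\Omega$ does $v$ agree almost everywhere on $\omega$ with a continuous function $\omega\to V$. -/

import Mathlib

open MeasureTheory TopologicalSpace
open scoped Distributions LineDeriv ContDiff

namespace FirstOrderOp

variable {n : ℕ} {V W : Type*}
  [NormedAddCommGroup V] [NormedSpace ℝ V] [NormedAddCommGroup W] [NormedSpace ℝ W]

/-- The Fourier symbol `𝔸[ξ] = ∑ j, ξ j • 𝔸 j` of the first-order homogeneous constant-coefficient
operator `𝔸 u = ∑ j, 𝔸 j (∂_j u)`. The operator is given by its coefficients `𝔸 j`. -/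
def symbol (A : Fin n → V →L[ℝ] W) (ξ : EuclideanSpace ℝ (Fin n)) : V →L[ℝ] W :=
  ∑ j, ξ j • A j

/-- `dim (im 𝔸[ξ])` is independent of `ξ ≠ 0`. -/
def HasConstantRank (A : Fin n → V →L[ℝ] W) : Prop :=
  ∀ ξ η : EuclideanSpace ℝ (Fin n), ξ ≠ 0 → η ≠ 0 →
    Module.finrank ℝ (symbol A ξ).range = Module.finrank ℝ (symbol A η).range

/-- `𝔸[ξ]` is injective for every `ξ ≠ 0`. -/
def IsElliptic (A : Fin n → V →L[ℝ] W) : Prop :=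
  ∀ ξ : EuclideanSpace ℝ (Fin n), ξ ≠ 0 → Function.Injective (symbol A ξ)

/-- The action of the operator on distributions, `𝔸 T = ∑ j, 𝔸 j (∂_j T)`, where `∂_j` is the
distributional partial derivative. -/
noncomputable def apply (A : Fin n → V →L[ℝ] W) {Ω : Opens (EuclideanSpace ℝ (Fin n))}
    (T : 𝓓'(Ω, V)) : 𝓓'(Ω, W) :=
  ∑ j, Distribution.mapCLM (A j) (∂_{EuclideanSpace.single j (1 : ℝ)} T)

/-- The distribution `φ ↦ ∫ φ(x) u(x) dx` on `Ω` given by `u ∈ L¹_loc(Ω; V)`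
(the zero distribution if `u` is not locally integrable on `Ω`). -/
noncomputable def toDistribution (Ω : Opens (EuclideanSpace ℝ (Fin n)))
    (u : EuclideanSpace ℝ (Fin n) → V) : 𝓓'(Ω, V) :=
  ContinuousLinearMap.toUniformConvergenceCLM _ _ _
    (TestFunction.integralAgainstBilinCLM (ContinuousLinearMap.lsmul ℝ ℝ) volume u)

/-- `u ∈ ker(𝔸; Ω) ∩ L¹_loc(Ω; V)`: `u` is locally integrable on `Ω` and `𝔸 u = 0` in `𝓓'(Ω; W)`.
Only the values of `u` on `Ω` matter. -/
def IsL1locSolution (A : Fin n → V →L[ℝ] W) (Ω : Opens (EuclideanSpace ℝ (Fin n)))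
    (u : EuclideanSpace ℝ (Fin n) → V) : Prop :=
  LocallyIntegrableOn u (Ω : Set (EuclideanSpace ℝ (Fin n))) volume ∧
    apply A (toDistribution Ω u) = 0

end FirstOrderOp

/-! For (a), a solution `u` is localized by a cutoff `η`. Testing `𝔸 u = 0` against `η` times a wave
of frequency `ξ` expresses `𝔸[ξ]` applied to the transform of `η u` through transforms of the
functions `(∂_j η) u` (`IsL1locSolution.symbol_wavePairing`). Ellipticity inverts `𝔸[ξ]` with a gain
of `‖ξ‖⁻¹`, and each `∂_j η` is again an admissible cutoff. Starting from the trivial `L¹` bound,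
iteration gives decay of every order, and Fourier inversion makes `η u` smooth. The local
representatives then glue. As `V` is real, the waves are cosines with a phase.

For (b), choose `ξ ≠ 0` and `v₀ ≠ 0` with `𝔸[ξ] v₀ = 0`. Formally `𝔸 (f(⟪ξ, x⟫) v₀) = f'(⟪ξ, x⟫)
𝔸[ξ] v₀ = 0`, and weakly this holds for every bounded measurable `f`. A profile `f` with a dense set
of jumps excludes a continuous representative on any open set. -/

namespace FirstOrderOp

/-! ### Weak formulation of the equation -/

section WeakForm

variable {n : ℕ} {V W : Type*}
  [NormedAddCommGroup V] [NormedSpace ℝ V] [NormedAddCommGroup W] [NormedSpace ℝ W]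

lemma toDistribution_apply {Ω : Opens (EuclideanSpace ℝ (Fin n))}
    {u : EuclideanSpace ℝ (Fin n) → V}
    (hu : LocallyIntegrableOn u (Ω : Set (EuclideanSpace ℝ (Fin n))) volume) (φ : 𝓓(Ω, ℝ)) :
    toDistribution Ω u φ = ∫ x, φ x • u x := by
  change TestFunction.integralAgainstBilinCLM (ContinuousLinearMap.lsmul ℝ ℝ) volume u φ = _
  rw [TestFunction.integralAgainstBilinCLM_eq_integral hu]
  rfl

/-- The weak formulation of `𝔸 u = 0` for a locally integrable function `u`. -/
lemma isL1locSolution_iff (A : Fin n → V →L[ℝ] W) (Ω : Opens (EuclideanSpace ℝ (Fin n)))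
    (u : EuclideanSpace ℝ (Fin n) → V) :
    IsL1locSolution A Ω u ↔
      LocallyIntegrableOn u (Ω : Set (EuclideanSpace ℝ (Fin n))) volume ∧
      ∀ φ : EuclideanSpace ℝ (Fin n) → ℝ, ContDiff ℝ ∞ φ → HasCompactSupport φ →
        tsupport φ ⊆ Ω →
        ∑ j, A j (∫ x, fderiv ℝ φ x (EuclideanSpace.single j 1) • u x) = 0 := by
  refine and_congr_right fun hu ↦ ?_
  have key (φ : 𝓓(Ω, ℝ)) : apply A (toDistribution Ω u) φ =
      -∑ j, A j (∫ x, fderiv ℝ φ x (EuclideanSpace.single j 1) • u x) := by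
    have h1 : apply A (toDistribution Ω u) φ =
        ∑ j, A j (toDistribution Ω u (-∂_{EuclideanSpace.single j (1 : ℝ)} φ)) := by
      simp_rw [apply, sum_apply, Distribution.mapCLM_apply,
        Distribution.lineDerivOp_apply_apply]
    rw [h1, ← Finset.sum_neg_distrib]
    refine Finset.sum_congr rfl fun j _ ↦ ?_
    rw [map_neg, map_neg, toDistribution_apply hu]
    congr 3
  constructor
  · intro h φ h1 h2 h3
    have := key ⟨φ, h1, h2, h3⟩
    rw [h] at this
    exact neg_eq_zero.mp this.symm
  · intro h
    ext φ
    rw [key, h φ φ.contDiff φ.hasCompactSupport φ.tsupport_subset]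
    simp

end WeakForm

/-! ### Rough plane-wave solutions -/

section PlaneWave

open scoped InnerProductSpace

/-- A bounded monotone function on the line that jumps at a dense set of points. -/
lemma exists_monotone_dense_jumps :
    ∃ f : ℝ → ℝ, Monotone f ∧ (∀ t, |f t| ≤ 2) ∧
      ∃ D : Set ℝ, Dense D ∧ ∀ q ∈ D, ∃ ε > 0, ∀ s < q, ∀ t ≥ q, f s + ε ≤ f t := by
  let q : ℕ → ℝ := denseSeq ℝ
  -- The profile is the sum over `k` of steps of height `2⁻ᵏ` at `q k`; the bound 2 is the geometric
  -- series, and the jump at `q k` is at least the height of the `k`-th step.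
  let a : ℝ → ℕ → ℝ := fun t k ↦ if q k ≤ t then (1 / 2) ^ k else 0
  have ha0 (t k) : 0 ≤ a t k := by simp only [a]; split_ifs <;> positivity
  have ha1 (t k) : a t k ≤ (1 / 2) ^ k := by
    simp only [a]; split_ifs
    · exact le_rfl
    · positivity
  have hsum (t) : Summable (a t) :=
    Summable.of_nonneg_of_le (ha0 t) (ha1 t) summable_geometric_two
  refine ⟨fun t ↦ ∑' k, a t k, ?_, ?_, Set.range q, denseRange_denseSeq ℝ, ?_⟩
  · intro s t hst
    refine (hsum s).tsum_le_tsum (fun k ↦ ?_) (hsum t)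
    simp only [a]
    split_ifs with h1 h2
    · exact le_rfl
    · exact absurd (h1.trans hst) h2
    · positivity
    · exact le_rfl
  · intro t
    rw [abs_of_nonneg (tsum_nonneg (ha0 t)), ← tsum_geometric_two]
    exact (hsum t).tsum_le_tsum (ha1 t) summable_geometric_two
  · rintro _ ⟨k, rfl⟩
    refine ⟨(1 / 2) ^ k, by positivity, fun s hs t ht ↦ ?_⟩
    have hk : Summable fun j : ℕ ↦ if j = k then ((1 : ℝ) / 2) ^ k else 0 :=
      (hasSum_ite_eq k _).summable
    calc ∑' j, a s j + (1 / 2) ^ k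
        = ∑' j, (a s j + if j = k then (1 / 2) ^ k else 0) := by
          rw [(hsum s).tsum_add hk, tsum_ite_eq]
      _ ≤ ∑' j, a t j := by
          refine ((hsum s).add hk).tsum_le_tsum (fun j ↦ ?_) (hsum t)
          simp only [a]
          by_cases hj : j = k
          · subst hj
            simp [not_le.mpr hs, ht]
          · simp only [hj, if_false, add_zero]
            split_ifs with h1 h2
            · exact le_rfl
            · exact absurd (h1.trans (hs.le.trans ht)) h2
            · positivity
            · exact le_rfl

variable {E : Type*} [NormedAddCommGroup E] [InnerProductSpace ℝ E] [FiniteDimensional ℝ E]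
  [MeasurableSpace E] [BorelSpace E]

/-- Integrating a plane wave against a directional derivative of a test function only sees the
component of the direction along the wave vector. -/
lemma integral_fderiv_mul_planeWave {f : ℝ → ℝ} (hf : Measurable f) {C : ℝ} (hC : ∀ t, |f t| ≤ C)
    {ξ : E} (hξ : ξ ≠ 0) {φ : E → ℝ} (hφ : ContDiff ℝ ∞ φ) (hφc : HasCompactSupport φ) (v : E) :
    ∫ x, fderiv ℝ φ x v * f ⟪ξ, x⟫_ℝ =
      ⟪ξ, v⟫_ℝ * ((‖ξ‖ ^ 2)⁻¹ * ∫ x, fderiv ℝ φ x ξ * f ⟪ξ, x⟫_ℝ) := by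
  have hξ' : ‖ξ‖ ^ 2 ≠ 0 := by simpa using hξ
  have hmeas : Measurable fun x : E ↦ f ⟪ξ, x⟫_ℝ :=
    hf.comp (innerSL ℝ ξ).continuous.measurable
  have hint {g : E → ℝ} (hg : Continuous g) (hgc : HasCompactSupport g) :
      Integrable fun x ↦ g x * f ⟪ξ, x⟫_ℝ :=
    (hg.integrable_of_hasCompactSupport hgc).mul_bdd (c := C) hmeas.aestronglyMeasurable
      (.of_forall fun x ↦ hC _)
  have hder (w : E) : Integrable fun x ↦ fderiv ℝ φ x w * f ⟪ξ, x⟫_ℝ :=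
    hint ((hφ.continuous_fderiv (by simp)).clm_apply continuous_const)
      (hφc.fderiv_apply (𝕜 := ℝ) w)
  -- Along `w ⟂ ξ` the wave is constant, so its line derivative exists and vanishes however rough
  -- `f` is, and integration by parts applies.
  have hperp (w : E) (hw : ⟪ξ, w⟫_ℝ = 0) : ∫ x, fderiv ℝ φ x w * f ⟪ξ, x⟫_ℝ = 0 := by
    have := integral_bilinear_hasLineDerivAt_right_eq_neg_left_of_integrable (μ := volume)
      (B := ContinuousLinearMap.mul ℝ ℝ) (f := fun x : E ↦ f ⟪ξ, x⟫_ℝ) (f' := fun _ ↦ 0)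
      (g := φ) (g' := fun x ↦ fderiv ℝ φ x w) (v := w) (by simp)
      (by simpa [mul_comm] using hder w)
      (by simpa [mul_comm] using hint hφ.continuous hφc)
      (fun x _ ↦ by
        simp only [HasLineDerivAt, inner_add_right, inner_smul_right, hw, mul_zero, add_zero]
        exact hasDerivAt_const _ _)
      (fun x _ ↦ (hφ.differentiable (by simp) x).hasFDerivAt.hasLineDerivAt w)
    simpa [mul_comm] using this
  -- `c • ξ` is the orthogonal projection of `v` onto the line of `ξ`.
  set c := ⟪ξ, v⟫_ℝ * (‖ξ‖ ^ 2)⁻¹ with hc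
  have h0 := hperp (v - c • ξ) (by
    rw [inner_sub_right, inner_smul_right, real_inner_self_eq_norm_sq, hc]
    field_simp
    ring)
  simp only [map_sub, map_smul, sub_mul, smul_eq_mul, mul_assoc c] at h0
  rw [integral_sub (hder v) ((hder ξ).const_mul c), integral_const_mul, sub_eq_zero] at h0
  rw [h0, hc, mul_assoc]

/-- A plane wave whose profile jumps at a dense set of points agrees almost everywhere with a
continuous function on no non-empty open set. -/
lemma not_ae_eq_continuousOn_planeWave {V : Type*} [NormedAddCommGroup V] [NormedSpace ℝ V]
    {f : ℝ → ℝ} {D : Set ℝ} (hD : Dense D)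
    (hf : ∀ q ∈ D, ∃ ε > 0, ∀ s < q, ∀ t ≥ q, f s + ε ≤ f t)
    {ξ : E} (hξ : ξ ≠ 0) {v₀ : V} (hv₀ : v₀ ≠ 0) {U : Set E} (hU : IsOpen U) (hne : U.Nonempty)
    {w : E → V} (hw : ContinuousOn w U)
    (h : (fun x ↦ f ⟪ξ, x⟫_ℝ • v₀) =ᵐ[volume.restrict U] w) : False := by
  have hopen : IsOpenMap (innerSL ℝ ξ : E → ℝ) := by
    refine (innerSL ℝ ξ).isOpenMap fun t ↦ ⟨(t * (‖ξ‖ ^ 2)⁻¹) • ξ, ?_⟩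
    have hξ' : ‖ξ‖ ^ 2 ≠ 0 := by simpa using hξ
    simp only [innerSL_apply_apply, inner_smul_right, real_inner_self_eq_norm_sq]
    field_simp
  obtain ⟨_, ⟨p, hpU, rfl⟩, hpD⟩ := hD.inter_open_nonempty _ (hopen U hU) (hne.image _)
  obtain ⟨ε, hε, hjump⟩ := hf _ hpD
  have hδ : 0 < ε * ‖v₀‖ / 2 := by positivity
  obtain ⟨N, hN, hNo, hpN⟩ : ∃ N ⊆ {x | x ∈ U ∧ dist (w x) (w p) < ε * ‖v₀‖ / 2},
      IsOpen N ∧ p ∈ N := by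
    rw [← mem_nhds_iff]
    exact Filter.inter_mem (hU.mem_nhds hpU)
      ((hw.continuousAt (hU.mem_nhds hpU)).eventually (Metric.ball_mem_nhds _ hδ))
  have hdense : Dense {x | x ∈ U → f ⟪ξ, x⟫_ℝ • v₀ = w x} :=
    Measure.dense_of_ae (ae_imp_of_ae_restrict h)
  -- The set where the wave equals `w` is only known to be dense in `U`, so it is met inside an open
  -- piece of `N` on a prescribed side of the hyperplane through `p`. The values found on the two
  -- sides differ by less than `ε * ‖v₀‖`, against the jump.
  have hside (I : Set ℝ) (hI : IsOpen I) (hpI : innerSL ℝ ξ p ∈ closure I) :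
      ∃ x, ⟪ξ, x⟫_ℝ ∈ I ∧ dist (f ⟪ξ, x⟫_ℝ • v₀) (w p) < ε * ‖v₀‖ / 2 := by
    obtain ⟨_, ⟨y, hyN, rfl⟩, hyI⟩ : ((innerSL ℝ ξ : E → ℝ) '' N ∩ I).Nonempty :=
      mem_closure_iff.mp hpI _ (hopen N hNo) ⟨p, hpN, rfl⟩
    obtain ⟨x, ⟨hxN, hxI⟩, hx⟩ := hdense.inter_open_nonempty (N ∩ (innerSL ℝ ξ : E → ℝ) ⁻¹' I)
      (hNo.inter (hI.preimage (innerSL ℝ ξ).continuous)) ⟨y, hyN, hyI⟩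
    refine ⟨x, hxI, ?_⟩
    rw [hx (hN hxN).1]
    exact (hN hxN).2
  obtain ⟨x, hx, hxd⟩ := hside (Set.Iio (innerSL ℝ ξ p)) isOpen_Iio (by simp)
  obtain ⟨y, hy, hyd⟩ := hside (Set.Ioi (innerSL ℝ ξ p)) isOpen_Ioi (by simp)
  have h1 := hjump _ hx _ (le_of_lt hy)
  have h2 := dist_triangle_right (f ⟪ξ, y⟫_ℝ • v₀) (f ⟪ξ, x⟫_ℝ • v₀) (w p)
  rw [dist_eq_norm, ← sub_smul, norm_smul] at h2
  have h3 : ε * ‖v₀‖ ≤ ‖f ⟪ξ, y⟫_ℝ - f ⟪ξ, x⟫_ℝ‖ * ‖v₀‖ := by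
    gcongr
    exact (by linarith : ε ≤ f ⟪ξ, y⟫_ℝ - f ⟪ξ, x⟫_ℝ).trans (le_abs_self _)
  linarith

variable {n : ℕ} {V W : Type*}
  [NormedAddCommGroup V] [NormedSpace ℝ V] [NormedAddCommGroup W] [NormedSpace ℝ W]

/-- A plane wave with wave vector `ξ` and amplitude in the kernel of `𝔸[ξ]` solves `𝔸 v = 0`. -/
lemma isL1locSolution_planeWave [CompleteSpace V] (A : Fin n → V →L[ℝ] W)
    (Ω : Opens (EuclideanSpace ℝ (Fin n)))
    {f : ℝ → ℝ} (hf : Measurable f) {C : ℝ} (hC : ∀ t, |f t| ≤ C)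
    {ξ : EuclideanSpace ℝ (Fin n)} (hξ : ξ ≠ 0) {v₀ : V} (hv₀ : symbol A ξ v₀ = 0) :
    IsL1locSolution A Ω fun x ↦ f ⟪ξ, x⟫_ℝ • v₀ := by
  rw [isL1locSolution_iff]
  constructor
  · have hmeas : Measurable fun x : EuclideanSpace ℝ (Fin n) ↦ f ⟪ξ, x⟫_ℝ :=
      hf.comp (innerSL ℝ ξ).continuous.measurable
    refine LocallyIntegrable.locallyIntegrableOn ?_ _
    refine (locallyIntegrable_const (C * ‖v₀‖)).mono
      (hmeas.aestronglyMeasurable.smul aestronglyMeasurable_const) (.of_forall fun x ↦ ?_)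
    rw [norm_smul]
    refine le_trans ?_ (le_abs_self _)
    gcongr
    exact hC _
  · intro φ hφ hφc _
    -- The scalar in front does not depend on `j`, so summation over `j` produces `symbol A ξ v₀`.
    have h (j : Fin n) : ∫ x, fderiv ℝ φ x (EuclideanSpace.single j 1) • f ⟪ξ, x⟫_ℝ • v₀ =
        ((‖ξ‖ ^ 2)⁻¹ * ∫ x, fderiv ℝ φ x ξ * f ⟪ξ, x⟫_ℝ) • ξ j • v₀ := by
      simp_rw [← smul_assoc, smul_eq_mul]
      rw [integral_smul_const, integral_fderiv_mul_planeWave hf hC hξ hφ hφc]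
      simp [EuclideanSpace.inner_single_right, mul_comm]
    simp only [h, map_smul, ← Finset.smul_sum]
    have : ∑ j, ξ j • A j v₀ = 0 := by simpa [symbol] using hv₀
    rw [this, smul_zero]

end PlaneWave

/-! ### Smoothness from Fourier decay -/

section FourierInversion

open scoped FourierTransform

variable {E : Type*} [NormedAddCommGroup E] [InnerProductSpace ℝ E] [FiniteDimensional ℝ E]
  [MeasurableSpace E] [BorelSpace E]

/-- An integrable function with rapidly decreasing Fourier transform is almost everywhere smooth. -/
lemma exists_contDiff_ae_eq_of_fourier_decay {f : E → ℂ} (hf : Integrable f)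
    (hdecay : ∀ k : ℕ, ∃ C : ℝ, ∀ ξ : E, ‖ξ‖ ^ k * ‖𝓕 f ξ‖ ≤ C) :
    ∃ g : E → ℂ, ContDiff ℝ ∞ g ∧ f =ᵐ[volume] g := by
  have hcont : Continuous (𝓕 f) :=
    VectorFourier.fourierIntegral_continuous Real.continuous_fourierChar
      (by simpa using continuous_inner) hf
  have hmom (k : ℕ) : Integrable fun ξ ↦ ‖ξ‖ ^ k * ‖𝓕 f ξ‖ := by
    obtain ⟨C₁, h₁⟩ := hdecay 0
    obtain ⟨C₂, h₂⟩ := hdecay (k + (volume : Measure E).integrablePower)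
    exact integrable_of_le_of_pow_mul_le (C₁ := C₁) (by simpa using h₁) h₂
      hcont.aestronglyMeasurable
  have hint : Integrable (𝓕 f) := by
    have := hmom 0
    simp only [pow_zero, one_mul] at this
    exact (integrable_norm_iff hcont.aestronglyMeasurable).mp this
  have hsmooth : ContDiff ℝ ∞ (𝓕⁻ (𝓕 f)) := by
    have h : 𝓕⁻ (𝓕 f) = (𝓕 (𝓕 f)) ∘ fun x ↦ -x := by
      ext x
      exact Real.fourierInv_eq_fourier_neg _ _
    rw [h]
    exact (Real.contDiff_fourier (N := ⊤) fun k _ ↦ hmom k).comp contDiff_neg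
  refine ⟨_, hsmooth, ?_⟩
  -- Pointwise inversion would need continuity of `f`. Instead both sides are tested against `φ = 𝓕
  -- ψ` with `ψ` Schwartz, and the multiplication formula `hswap` is applied twice.
  refine ae_eq_of_integral_contDiff_smul_eq hf.locallyIntegrable
    hsmooth.continuous.locallyIntegrable fun φ hφ hφc ↦ ?_
  let φ' : SchwartzMap E ℂ := HasCompactSupport.toSchwartzMap
    (f := fun x ↦ (φ x : ℂ)) (hφc.comp_left (g := fun t : ℝ ↦ (t : ℂ)) (by simp))
    (Complex.ofRealCLM.contDiff.comp hφ)
  have hφ' (x : E) : φ' x = (φ x : ℂ) := rfl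
  let ψ : SchwartzMap E ℂ := 𝓕⁻ φ'
  have hψ : 𝓕 (ψ : E → ℂ) = φ' := by
    have : 𝓕 ψ = φ' := by simp [ψ]
    rw [← SchwartzMap.fourier_coe, this]
  have hswap {a b : E → ℂ} (ha : Integrable a) (hb : Integrable b) :
      ∫ ξ, 𝓕 a ξ * b ξ = ∫ x, a x * 𝓕 b x := by
    have := VectorFourier.integral_fourierIntegral_smul_eq_flip (L := innerₗ E) (f := a) (g := b)
      (μ := volume) (ν := volume) Real.continuous_fourierChar (by simpa using continuous_inner)
      ha hb
    simpa using! this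
  have hneg : ∀ x, ψ (-x) = 𝓕 (φ' : E → ℂ) x := by
    intro x
    simp only [ψ, SchwartzMap.fourierInv_coe, Real.fourierInv_eq_fourier_neg, neg_neg]
  calc ∫ x, φ x • f x = ∫ x, f x * 𝓕 (ψ : E → ℂ) x := by
        simp [hψ, hφ', mul_comm]
    _ = ∫ ξ, 𝓕 f ξ * ψ ξ := (hswap hf ψ.integrable).symm
    _ = ∫ ξ, 𝓕 f (-ξ) * 𝓕 (φ' : E → ℂ) ξ := by
        rw [← integral_neg_eq_self]
        simp_rw [hneg]
    _ = ∫ x, 𝓕 (fun ξ ↦ 𝓕 f (-ξ)) x * φ' x := (hswap hint.comp_neg φ'.integrable).symm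
    _ = ∫ x, φ x • 𝓕⁻ (𝓕 f) x := by
        rw [Real.fourierInv_eq_fourier_comp_neg]
        simp [hφ', mul_comm]

end FourierInversion

/-! ### Decay of localized solutions and gluing -/

section EllipticRegularity

open scoped InnerProductSpace FourierTransform

variable {n : ℕ} {V W : Type*}
  [NormedAddCommGroup V] [NormedSpace ℝ V] [NormedAddCommGroup W] [NormedSpace ℝ W]

lemma symbol_smul (A : Fin n → V →L[ℝ] W) (c : ℝ) (ξ : EuclideanSpace ℝ (Fin n)) :
    symbol A (c • ξ) = c • symbol A ξ := by
  simp [symbol, Finset.smul_sum, smul_smul]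

lemma continuous_symbol (A : Fin n → V →L[ℝ] W) : Continuous (symbol A) := by
  unfold symbol
  fun_prop

/-- By compactness, ellipticity is quantitative. -/
lemma IsElliptic.exists_norm_mul_norm_le [FiniteDimensional ℝ V] {A : Fin n → V →L[ℝ] W}
    (hA : IsElliptic A) :
    ∃ C : ℝ, 0 ≤ C ∧ ∀ (ξ : EuclideanSpace ℝ (Fin n)) (v : V),
      ‖ξ‖ * ‖v‖ ≤ C * ‖symbol A ξ v‖ := by
  let K : Set (EuclideanSpace ℝ (Fin n) × V) := Metric.sphere 0 1 ×ˢ Metric.sphere 0 1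
  have hK : IsCompact K := (isCompact_sphere _ _).prod (isCompact_sphere _ _)
  have hcont : Continuous fun p : EuclideanSpace ℝ (Fin n) × V ↦ ‖symbol A p.1 p.2‖ :=
    (((continuous_symbol A).comp continuous_fst).clm_apply continuous_snd).norm
  obtain ⟨c, hc, hcK⟩ : ∃ c : ℝ, 0 < c ∧ ∀ p ∈ K, c ≤ ‖symbol A p.1 p.2‖ := by
    refine hK.exists_forall_le' hcont.continuousOn fun p hp ↦ ?_
    have h1 : ‖p.1‖ = 1 := by simpa using hp.1
    have h2 : ‖p.2‖ = 1 := by simpa using hp.2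
    rw [norm_pos_iff]
    intro h
    have : p.2 = 0 := hA p.1 (norm_ne_zero_iff.mp (by simp [h1])) (by simpa using h)
    simp [this] at h2
  refine ⟨c⁻¹, by positivity, fun ξ v ↦ ?_⟩
  rcases eq_or_ne ξ 0 with rfl | hξ
  · simp; positivity
  rcases eq_or_ne v 0 with rfl | hv
  · simp
  have hξ' : 0 < ‖ξ‖ := norm_pos_iff.mpr hξ
  have hv' : 0 < ‖v‖ := norm_pos_iff.mpr hv
  have := hcK (‖ξ‖⁻¹ • ξ, ‖v‖⁻¹ • v) (by
    constructor <;> simp [norm_smul, hξ, hv])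
  simp only [symbol_smul, map_smul, _root_.smul_apply, norm_smul, norm_inv,
    norm_norm] at this
  rw [inv_mul_eq_div, inv_mul_eq_div, div_div, le_div_iff₀ (by positivity)] at this
  rw [inv_mul_eq_div, le_div_iff₀ hc]
  linarith

/-- The pairing of `u` with the test function `η` modulated by a real wave with frequency `ξ` and
phase `θ`. -/
noncomputable def wavePairing (u : EuclideanSpace ℝ (Fin n) → V)
    (η : EuclideanSpace ℝ (Fin n) → ℝ) (ξ : EuclideanSpace ℝ (Fin n)) (θ : ℝ) : V :=
  ∫ x, (η x * Real.cos (2 * Real.pi * ⟪x, ξ⟫_ℝ + θ)) • u x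

lemma integrable_smul_of_tsupport_subset {Ω : Opens (EuclideanSpace ℝ (Fin n))}
    {u : EuclideanSpace ℝ (Fin n) → V}
    (hu : LocallyIntegrableOn u (Ω : Set (EuclideanSpace ℝ (Fin n))) volume)
    {η : EuclideanSpace ℝ (Fin n) → ℝ} (hη : ContDiff ℝ ∞ η) (hηc : HasCompactSupport η)
    (hηΩ : tsupport η ⊆ Ω) : Integrable fun x ↦ η x • u x :=
  TestFunction.integrable_bilin (ContinuousLinearMap.lsmul ℝ ℝ) hu
    (⟨η, hη, hηc, hηΩ⟩ : 𝓓(Ω, ℝ))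

/-- Testing `𝔸 u = 0` against modulated test functions: multiplying the transform of `η u` by
the symbol only costs derivatives of the cutoff `η`. -/
lemma IsL1locSolution.symbol_wavePairing {A : Fin n → V →L[ℝ] W}
    {Ω : Opens (EuclideanSpace ℝ (Fin n))} {u : EuclideanSpace ℝ (Fin n) → V}
    (hu : IsL1locSolution A Ω u)
    {η : EuclideanSpace ℝ (Fin n) → ℝ} (hη : ContDiff ℝ ∞ η) (hηc : HasCompactSupport η)
    (hηΩ : tsupport η ⊆ Ω) (ξ : EuclideanSpace ℝ (Fin n)) (θ : ℝ) :
    (2 * Real.pi) • symbol A ξ (wavePairing u η ξ θ) =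
      ∑ j, A j (wavePairing u (fun x ↦ fderiv ℝ η x (EuclideanSpace.single j 1)) ξ
        (θ + Real.pi / 2)) := by
  obtain ⟨hloc, hweak⟩ := (isL1locSolution_iff A Ω u).mp hu
  -- The extra phase `π / 2` makes differentiation return a multiple of the cosine with phase `θ`.
  set m : EuclideanSpace ℝ (Fin n) → ℝ :=
    fun x ↦ Real.cos (2 * Real.pi * ⟪x, ξ⟫_ℝ + (θ + Real.pi / 2)) with hm
  have hcos (α : ℝ) : ContDiff ℝ ∞ fun x : EuclideanSpace ℝ (Fin n) ↦
      Real.cos (2 * Real.pi * ⟪x, ξ⟫_ℝ + α) :=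
    Real.contDiff_cos.comp
      ((contDiff_const.mul (contDiff_id.inner ℝ contDiff_const)).add contDiff_const)
  have hms : ContDiff ℝ ∞ m := hcos _
  have hmd (x : EuclideanSpace ℝ (Fin n)) (j : Fin n) :
      fderiv ℝ m x (EuclideanSpace.single j 1) =
        -(2 * Real.pi * ξ j * Real.cos (2 * Real.pi * ⟪x, ξ⟫_ℝ + θ)) := by
    have h1 : HasFDerivAt (fun y : EuclideanSpace ℝ (Fin n) ↦
        2 * Real.pi * ⟪y, ξ⟫_ℝ + (θ + Real.pi / 2)) ((2 * Real.pi) • innerSL ℝ ξ) x := by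
      refine HasFDerivAt.add_const _ (HasFDerivAt.const_mul ?_ _)
      exact (innerSL ℝ ξ).hasFDerivAt.congr_of_eventuallyEq
        (.of_forall fun y ↦ real_inner_comm ξ y)
    rw [(h1.cos).fderiv]
    have h2 : Real.sin (2 * Real.pi * ⟪x, ξ⟫_ℝ + (θ + Real.pi / 2)) =
        Real.cos (2 * Real.pi * ⟪x, ξ⟫_ℝ + θ) := by
      rw [← add_assoc, Real.sin_add_pi_div_two]
    simp [h2, EuclideanSpace.inner_single_right]
    ring
  have hcosint {ζ : EuclideanSpace ℝ (Fin n) → ℝ} (hζ : ContDiff ℝ ∞ ζ)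
      (hζc : HasCompactSupport ζ) (hζΩ : tsupport ζ ⊆ Ω) (α : ℝ) :
      Integrable fun x ↦ (ζ x * Real.cos (2 * Real.pi * ⟪x, ξ⟫_ℝ + α)) • u x :=
    integrable_smul_of_tsupport_subset hloc (η := fun x ↦ ζ x * _)
      (hζ.mul (hcos α)) hζc.mul_right ((tsupport_mul_subset_left).trans hζΩ)
  have key (j : Fin n) :
      ∫ x, fderiv ℝ (fun x ↦ η x * m x) x (EuclideanSpace.single j 1) • u x =
        wavePairing u (fun x ↦ fderiv ℝ η x (EuclideanSpace.single j 1)) ξ (θ + Real.pi / 2) -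
          (2 * Real.pi * ξ j) • wavePairing u η ξ θ := by
    have hd : ContDiff ℝ ∞ fun x ↦ fderiv ℝ η x (EuclideanSpace.single j 1) :=
      (hη.fderiv_right (by simp)).clm_apply contDiff_const
    have hint : Integrable fun x ↦ (2 * Real.pi * ξ j) •
        (η x * Real.cos (2 * Real.pi * ⟪x, ξ⟫_ℝ + θ)) • u x :=
      (hcosint hη hηc hηΩ _).smul _
    rw [wavePairing, wavePairing, ← integral_smul, ← integral_sub
      (hcosint hd (hηc.fderiv_apply (𝕜 := ℝ) _)
        ((tsupport_fderiv_apply_subset ℝ _).trans hηΩ) _) hint]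
    congr 1
    ext x
    have h1 : fderiv ℝ (fun x ↦ η x * m x) x =
        η x • fderiv ℝ m x + m x • fderiv ℝ η x :=
      fderiv_fun_mul (hη.differentiable (by simp) x) (hms.differentiable (by simp) x)
    rw [h1]
    simp only [_root_.add_apply, _root_.smul_apply, hmd, smul_eq_mul,
      smul_smul, ← sub_smul]
    congr 1
    simp only [hm]
    ring
  have hsum := hweak (fun x ↦ η x * m x) (hη.mul hms) hηc.mul_right
    (tsupport_mul_subset_left.trans hηΩ)
  simp only [key, map_sub, Finset.sum_sub_distrib, map_smul, sub_eq_zero] at hsum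
  rw [hsum, symbol]
  simp [Finset.smul_sum, smul_smul]

/-- The transform of a localized solution of an elliptic equation decays rapidly. -/
lemma IsL1locSolution.exists_pow_mul_norm_wavePairing_le [FiniteDimensional ℝ V]
    {A : Fin n → V →L[ℝ] W} (hA : IsElliptic A)
    {Ω : Opens (EuclideanSpace ℝ (Fin n))} {u : EuclideanSpace ℝ (Fin n) → V}
    (hu : IsL1locSolution A Ω u) (k : ℕ)
    {η : EuclideanSpace ℝ (Fin n) → ℝ} (hη : ContDiff ℝ ∞ η) (hηc : HasCompactSupport η)
    (hηΩ : tsupport η ⊆ Ω) :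
    ∃ C : ℝ, ∀ ξ θ, ‖ξ‖ ^ k * ‖wavePairing u η ξ θ‖ ≤ C := by
  -- Each power of `‖ξ‖` costs one derivative of the cutoff and a phase shift, so the claim must
  -- cover all `η` and be uniform in `θ`.
  induction k generalizing η with
  | zero =>
    refine ⟨∫ x, ‖η x • u x‖, fun ξ θ ↦ ?_⟩
    rw [pow_zero, one_mul]
    refine norm_integral_le_of_norm_le
      (integrable_smul_of_tsupport_subset hu.1 hη hηc hηΩ).norm (.of_forall fun x ↦ ?_)
    rw [norm_smul, norm_smul, norm_mul]
    gcongr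
    exact mul_le_of_le_one_right (norm_nonneg _) (Real.abs_cos_le_one _)
  | succ k ih =>
    obtain ⟨c, hc, hell⟩ := hA.exists_norm_mul_norm_le
    have hd (j : Fin n) : ∃ C : ℝ, ∀ ξ θ, ‖ξ‖ ^ k *
        ‖wavePairing u (fun x ↦ fderiv ℝ η x (EuclideanSpace.single j 1)) ξ θ‖ ≤ C :=
      ih ((hη.fderiv_right (by simp)).clm_apply contDiff_const) (hηc.fderiv_apply (𝕜 := ℝ) _)
        ((tsupport_fderiv_apply_subset ℝ _).trans hηΩ)
    choose C hC using hd
    refine ⟨c * ∑ j, ‖A j‖ * C j, fun ξ θ ↦ ?_⟩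
    set F := wavePairing u η ξ θ
    have hsym : ‖symbol A ξ F‖ ≤ ∑ j, ‖A j‖ *
        ‖wavePairing u (fun x ↦ fderiv ℝ η x (EuclideanSpace.single j 1)) ξ
          (θ + Real.pi / 2)‖ := by
      calc ‖symbol A ξ F‖ ≤ (2 * Real.pi) * ‖symbol A ξ F‖ :=
            le_mul_of_one_le_left (norm_nonneg _) (by linarith [Real.pi_gt_three])
        _ = ‖(2 * Real.pi) • symbol A ξ F‖ := by
            rw [norm_smul, Real.norm_of_nonneg (by positivity)]
        _ ≤ _ := by
            rw [hu.symbol_wavePairing hη hηc hηΩ]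
            exact norm_sum_le_of_le _ fun j _ ↦ (A j).le_opNorm _
    calc ‖ξ‖ ^ (k + 1) * ‖F‖ = ‖ξ‖ ^ k * (‖ξ‖ * ‖F‖) := by ring
      _ ≤ ‖ξ‖ ^ k * (c * ∑ j, ‖A j‖ *
          ‖wavePairing u (fun x ↦ fderiv ℝ η x (EuclideanSpace.single j 1)) ξ
            (θ + Real.pi / 2)‖) := by
          refine mul_le_mul_of_nonneg_left ?_ (by positivity)
          exact (hell ξ F).trans (mul_le_mul_of_nonneg_left hsym hc)
      _ = c * ∑ j, ‖A j‖ * (‖ξ‖ ^ k *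
          ‖wavePairing u (fun x ↦ fderiv ℝ η x (EuclideanSpace.single j 1)) ξ
            (θ + Real.pi / 2)‖) := by
          rw [mul_left_comm, Finset.mul_sum]
          congr 1
          exact Finset.sum_congr rfl fun j _ ↦ mul_left_comm _ _ _
      _ ≤ c * ∑ j, ‖A j‖ * C j := by
          gcongr with j
          exact hC j _ _

/-- Since `cos (t + π / 2) = -sin t`, the phases `0` and `π / 2` give the real and imaginary parts
of `exp (-i t)`. This transfers the decay of the real pairings to the complex Fourier transform. -/
lemma fourier_apply_smul_eq_wavePairing [FiniteDimensional ℝ V] (ℓ : V →L[ℝ] ℝ)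
    {u : EuclideanSpace ℝ (Fin n) → V} {η : EuclideanSpace ℝ (Fin n) → ℝ}
    (h : Integrable fun x ↦ η x • u x) (ξ : EuclideanSpace ℝ (Fin n)) :
    𝓕 (fun x ↦ (ℓ (η x • u x) : ℂ)) ξ =
      ℓ (wavePairing u η ξ 0) + ℓ (wavePairing u η ξ (Real.pi / 2)) * Complex.I := by
  have hint (θ : ℝ) :
      Integrable fun x ↦ (η x * Real.cos (2 * Real.pi * ⟪x, ξ⟫_ℝ + θ)) • u x := by
    have : Integrable fun x ↦ Real.cos (2 * Real.pi * ⟪x, ξ⟫_ℝ + θ) • η x • u x :=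
      h.bdd_smul (φ := fun x ↦ Real.cos (2 * Real.pi * ⟪x, ξ⟫_ℝ + θ)) 1
        (Continuous.aestronglyMeasurable (by fun_prop))
        (.of_forall fun x ↦ Real.abs_cos_le_one _)
    simpa only [smul_smul, mul_comm] using this
  have hpair (θ : ℝ) : (ℓ (wavePairing u η ξ θ) : ℂ) =
      ∫ x, ((η x * Real.cos (2 * Real.pi * ⟪x, ξ⟫_ℝ + θ) * ℓ (u x) : ℝ) : ℂ) := by
    rw [wavePairing, ← ℓ.integral_comp_comm (hint θ), ← integral_complex_ofReal]
    simp only [map_smul, smul_eq_mul]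
  have hint' (θ : ℝ) : Integrable fun x ↦
      ((η x * Real.cos (2 * Real.pi * ⟪x, ξ⟫_ℝ + θ) * ℓ (u x) : ℝ) : ℂ) := by
    have := (ℓ.integrable_comp (hint θ)).ofReal (𝕜 := ℂ)
    simpa only [map_smul, smul_eq_mul] using! this
  rw [hpair, hpair, ← integral_mul_const, ← integral_add (hint' 0) ((hint' _).mul_const _),
    Real.fourier_eq']
  congr 1
  ext x
  have : Complex.exp (↑(-2 * Real.pi * ⟪x, ξ⟫_ℝ) * Complex.I) =
      Real.cos (2 * Real.pi * ⟪x, ξ⟫_ℝ) +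
        Real.cos (2 * Real.pi * ⟪x, ξ⟫_ℝ + Real.pi / 2) * Complex.I := by
    rw [Complex.exp_mul_I, Real.cos_add_pi_div_two, ← Complex.ofReal_cos, ← Complex.ofReal_sin,
      neg_mul, neg_mul, Real.cos_neg, Real.sin_neg]
  rw [this, map_smul]
  push_cast
  simp only [smul_eq_mul, add_zero, Complex.ofReal_mul]
  ring

/-- A localized solution of an elliptic equation is almost everywhere smooth. -/
lemma IsL1locSolution.exists_contDiff_ae_eq_smul [FiniteDimensional ℝ V]
    {A : Fin n → V →L[ℝ] W} (hA : IsElliptic A)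
    {Ω : Opens (EuclideanSpace ℝ (Fin n))} {u : EuclideanSpace ℝ (Fin n) → V}
    (hu : IsL1locSolution A Ω u)
    {η : EuclideanSpace ℝ (Fin n) → ℝ} (hη : ContDiff ℝ ∞ η) (hηc : HasCompactSupport η)
    (hηΩ : tsupport η ⊆ Ω) :
    ∃ g : EuclideanSpace ℝ (Fin n) → V, ContDiff ℝ ∞ g ∧ (fun x ↦ η x • u x) =ᵐ[volume] g := by
  have hint := integrable_smul_of_tsupport_subset hu.1 hη hηc hηΩ
  have hscalar (ℓ : V →L[ℝ] ℝ) : ∃ g : EuclideanSpace ℝ (Fin n) → ℝ,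
      ContDiff ℝ ∞ g ∧ (fun x ↦ ℓ (η x • u x)) =ᵐ[volume] g := by
    obtain ⟨g, hg, hfg⟩ := exists_contDiff_ae_eq_of_fourier_decay
      (f := fun x ↦ (ℓ (η x • u x) : ℂ)) (ℓ.integrable_comp hint).ofReal fun k ↦ by
        obtain ⟨C, hC⟩ := hu.exists_pow_mul_norm_wavePairing_le hA k hη hηc hηΩ
        refine ⟨‖ℓ‖ * C + ‖ℓ‖ * C, fun ξ ↦ ?_⟩
        have hb (θ : ℝ) : ‖ξ‖ ^ k * ‖ℓ (wavePairing u η ξ θ)‖ ≤ ‖ℓ‖ * C :=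
          calc ‖ξ‖ ^ k * ‖ℓ (wavePairing u η ξ θ)‖
              ≤ ‖ξ‖ ^ k * (‖ℓ‖ * ‖wavePairing u η ξ θ‖) := by
                gcongr
                exact ℓ.le_opNorm _
            _ = ‖ℓ‖ * (‖ξ‖ ^ k * ‖wavePairing u η ξ θ‖) := by ring
            _ ≤ ‖ℓ‖ * C := by
                gcongr
                exact hC ξ θ
        rw [fourier_apply_smul_eq_wavePairing ℓ hint]
        refine le_trans ?_ (add_le_add (hb 0) (hb (Real.pi / 2)))
        rw [← mul_add]
        gcongr
        refine (norm_add_le _ _).trans ?_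
        simp
    refine ⟨fun x ↦ (g x).re, Complex.reCLM.contDiff.comp hg, ?_⟩
    filter_upwards [hfg] with x hx
    rw [← hx, Complex.ofReal_re]
  let b := Module.finBasis ℝ V
  choose g hg hug using fun i ↦ hscalar (b.coord i).toContinuousLinearMap
  refine ⟨fun x ↦ ∑ i, g i x • b i, ContDiff.sum fun i _ ↦ (hg i).smul contDiff_const, ?_⟩
  filter_upwards [Filter.eventually_all.mpr hug] with x hx
  rw [← b.sum_repr (η x • u x)]
  refine Finset.sum_congr rfl fun i _ ↦ ?_
  rw [← hx i]
  rfl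

/-- Functions which locally agree almost everywhere with smooth functions do so globally. -/
lemma exists_contDiffOn_ae_eq_of_locally {E : Type*} [NormedAddCommGroup E] [NormedSpace ℝ E]
    [MeasurableSpace E] [OpensMeasurableSpace E] [SecondCountableTopology E] {μ : Measure E}
    [μ.IsOpenPosMeasure] {Ω : Set E} (hΩ : IsOpen Ω) {u : E → V}
    (h : ∀ x ∈ Ω, ∃ N : Set E, IsOpen N ∧ x ∈ N ∧ ∃ g : E → V, ContDiff ℝ ∞ g ∧
      u =ᵐ[μ.restrict N] g) :
    ∃ w : E → V, ContDiffOn ℝ ∞ w Ω ∧ u =ᵐ[μ.restrict Ω] w := by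
  choose! N hNo hxN g hg hug using h
  -- Continuous representatives that agree almost everywhere on the open overlap agree at each of
  -- its points. Hence the diagonal `y ↦ g y y` coincides with `g x` near `x`.
  have hw (x) (hx : x ∈ Ω) (y) (hy : y ∈ Ω) (hyN : y ∈ N x) : g y y = g x y := by
    have hx' := ae_restrict_of_ae_restrict_of_subset (Set.inter_subset_left (t := N y)) (hug x hx)
    have hy' := ae_restrict_of_ae_restrict_of_subset (Set.inter_subset_right (s := N x)) (hug y hy)
    have hxy : g y =ᵐ[μ.restrict (N x ∩ N y)] g x := by
      filter_upwards [hx', hy'] with z hz hz'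
      rw [← hz, ← hz']
    exact Measure.eqOn_open_of_ae_eq hxy ((hNo x hx).inter (hNo y hy))
      (hg y hy).continuous.continuousOn (hg x hx).continuous.continuousOn ⟨hyN, hxN y hy⟩
  refine ⟨fun y ↦ g y y, fun x hx ↦ ?_, ?_⟩
  · refine (hg x hx).contDiffAt.contDiffWithinAt.congr_of_eventuallyEq ?_ rfl
    filter_upwards [self_mem_nhdsWithin,
      mem_nhdsWithin_of_mem_nhds ((hNo x hx).mem_nhds (hxN x hx))] with y hy hyN
    exact hw x hx y hy hyN
  · rw [Filter.EventuallyEq, ae_restrict_iff' hΩ.measurableSet]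
    refine measure_null_of_locally_null _ fun x hx ↦ ?_
    have hxΩ : x ∈ Ω := by
      by_contra h
      exact hx fun h' ↦ absurd h' h
    refine ⟨_ ∩ N x, Filter.inter_mem self_mem_nhdsWithin
      (mem_nhdsWithin_of_mem_nhds ((hNo x hxΩ).mem_nhds (hxN x hxΩ))), ?_⟩
    have hux := (ae_restrict_iff' (hNo x hxΩ).measurableSet).mp (hug x hxΩ)
    refine measure_mono_null ?_ (ae_iff.mp hux)
    rintro y ⟨hy, hyN⟩ hy'
    refine hy fun hyΩ ↦ ?_
    rw [hy' hyN, hw x hxΩ y hyΩ hyN]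

end EllipticRegularity

/-! ### The two halves of the dichotomy -/

section MainResults

variable {n : ℕ} {V W : Type*}
  [NormedAddCommGroup V] [NormedSpace ℝ V] [NormedAddCommGroup W] [NormedSpace ℝ W]

/-- Elliptic regularity: locally integrable solutions of `𝔸 u = 0` are almost everywhere smooth. -/
theorem IsL1locSolution.exists_contDiffOn_ae_eq [FiniteDimensional ℝ V]
    {A : Fin n → V →L[ℝ] W} (hA : IsElliptic A)
    {Ω : Opens (EuclideanSpace ℝ (Fin n))} {u : EuclideanSpace ℝ (Fin n) → V}
    (hu : IsL1locSolution A Ω u) :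
    ∃ w : EuclideanSpace ℝ (Fin n) → V,
      ContDiffOn ℝ ∞ w (Ω : Set (EuclideanSpace ℝ (Fin n))) ∧
      u =ᵐ[volume.restrict (Ω : Set (EuclideanSpace ℝ (Fin n)))] w := by
  refine exists_contDiffOn_ae_eq_of_locally Ω.isOpen fun x hx ↦ ?_
  obtain ⟨r, hr, hrΩ⟩ := Metric.nhds_basis_closedBall.mem_iff.mp (Ω.isOpen.mem_nhds hx)
  -- The support is the closed `r`-ball, which lies in `Ω`; on the ball of radius `r / 2` the bump
  -- is 1, so `η u = u` there.
  let η : ContDiffBump x := ⟨r / 2, r, by positivity, by linarith⟩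
  obtain ⟨g, hg, hug⟩ := hu.exists_contDiff_ae_eq_smul hA (η := η) η.contDiff
    η.hasCompactSupport (by rwa [η.tsupport_eq])
  refine ⟨Metric.ball x (r / 2), Metric.isOpen_ball, Metric.mem_ball_self (by positivity),
    g, hg, ?_⟩
  rw [Filter.EventuallyEq, ae_restrict_iff' Metric.isOpen_ball.measurableSet]
  filter_upwards [hug] with y hy hyB
  rw [← hy, η.one_of_mem_closedBall (Metric.ball_subset_closedBall hyB), one_smul]

/-- If ellipticity fails, some plane wave solution of `𝔸 v = 0` is nowhere continuous, even after
modification on a null set. -/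
theorem exists_isL1locSolution_nowhere_continuous [CompleteSpace V] {A : Fin n → V →L[ℝ] W}
    (hA : ¬ IsElliptic A) (Ω : Opens (EuclideanSpace ℝ (Fin n))) :
    ∃ v : EuclideanSpace ℝ (Fin n) → V, IsL1locSolution A Ω v ∧
      ∀ U : Set (EuclideanSpace ℝ (Fin n)), IsOpen U → U.Nonempty →
        ¬ ∃ w : EuclideanSpace ℝ (Fin n) → V,
          ContinuousOn w U ∧ v =ᵐ[volume.restrict U] w := by
  obtain ⟨ξ, hξ, hinj⟩ : ∃ ξ, ξ ≠ 0 ∧ ¬ Function.Injective (symbol A ξ) := by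
    simpa [IsElliptic] using hA
  obtain ⟨v₀, hv₀, hne⟩ : ∃ v₀, symbol A ξ v₀ = 0 ∧ v₀ ≠ 0 := by
    simpa [injective_iff_map_eq_zero] using hinj
  obtain ⟨f, hf, hf2, D, hD, hjump⟩ := exists_monotone_dense_jumps
  refine ⟨_, isL1locSolution_planeWave A Ω hf.measurable hf2 hξ hv₀, ?_⟩
  rintro U hU hUne ⟨w, hw, h⟩
  exact not_ae_eq_continuousOn_planeWave hD hjump hξ hne hU hUne hw h

end MainResults

end FirstOrderOp

theorem corollary4p3 {n : ℕ} {V W : Type*}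
    [NormedAddCommGroup V] [NormedSpace ℝ V] [FiniteDimensional ℝ V]
    [NormedAddCommGroup W] [NormedSpace ℝ W] [FiniteDimensional ℝ W]
    (Ω : Opens (EuclideanSpace ℝ (Fin n)))
    (A : Fin n → V →L[ℝ] W) (hA : FirstOrderOp.HasConstantRank A) :
    (FirstOrderOp.IsElliptic A →
      ∀ u : EuclideanSpace ℝ (Fin n) → V, FirstOrderOp.IsL1locSolution A Ω u →
        ∃ w : EuclideanSpace ℝ (Fin n) → V,
          ContDiffOn ℝ ∞ w (Ω : Set (EuclideanSpace ℝ (Fin n))) ∧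
          u =ᵐ[volume.restrict (Ω : Set (EuclideanSpace ℝ (Fin n)))] w) ∧
    (¬ FirstOrderOp.IsElliptic A →
      ∃ v : EuclideanSpace ℝ (Fin n) → V, FirstOrderOp.IsL1locSolution A Ω v ∧
        ∀ U : Set (EuclideanSpace ℝ (Fin n)), IsOpen U → U.Nonempty → U ⊆ Ω →
          ¬ ∃ w : EuclideanSpace ℝ (Fin n) → V,
            ContinuousOn w U ∧ v =ᵐ[volume.restrict U] w) := by
  refine ⟨fun hell u hu ↦ hu.exists_contDiffOn_ae_eq hell, fun hne ↦ ?_⟩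
  obtain ⟨v, hv, hv'⟩ := FirstOrderOp.exists_isL1locSolution_nowhere_continuous hne Ω
  exact ⟨v, hv, fun U hU hUne _ ↦ hv' U hU hUne⟩
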